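/- Let $\mathcal H$ be a real Hilbert space with scalar product $\langle\cdot,\cdot\rangle$ and norm $\|\cdot\|$. Let $f,g\colon\mathcal H\to\,]-\infty,+\infty]$ be proper, convex and lower semicontinuous with $\operatorname{dom} g\subset\operatorname{dom} f$, and suppose that $f$ is Gâteaux differentiable on $\operatorname{dom} g$ and that $\nabla f$ is $L$-Lipschitz continuous on $\operatorname{dom} g$ for some $L\in[0,+\infty[$ (no assumption is made on $\nabla f$ outside $\operatorname{dom} g$). For $k\in\mathbb N$ let $\langle x,y\rangle_k=\langle x,W_ky\rangle$ be scalar products on $\mathcal H$, with positive operators $W_k$ and norms $\|x\|_k^2=\langle x,W_kx\rangle$, such that for some $0<\nu\le\mu$ one has $\nu\|\cdot\|^2\le\|\cdot\|_k^2\le\mu\|\cdot\|^2$ for all $k$. Put $\nu_k=\inf_{\|x\|=1}\langle x,W_kx\rangle$ and $\mu_k=\sup_{\|x\|=1}\langle x,W_kx\rangle$ (the minimum and maximum eigenvalue of $W_k$). Assume that at least one of the following holds: * there are $\eta_k\ge0$ with $\sum_k\eta_k<+\infty$ and $\|\cdot\|_{k+1}^2\le(1+\eta_k)\|\cdot\|_k^2$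 for all $k$; * $\sum_k(\mu_k-\nu_k)<+\infty$. Let $\gamma_k>0$ and $\lambda_k\in\,]0,1]$ satisfy $\inf_k\lambda_k>0$, $\inf_k\gamma_k>0$ and $\sup_k\gamma_k\lambda_k/\nu_k<2/L$ (with $2/0=+\infty$). Let $x_0\in\operatorname{dom} g$ and, for all $k\in\mathbb N$, $$y_k=\mathrm{prox}^k_{\gamma_kg}\big(x_k-\gamma_k\nabla^kf(x_k)\big),\qquad x_{k+1}=x_k+\lambda_k(y_k-x_k),$$ where $\nabla^kf$ is the gradient of $f$ with respect to $\langle\cdot,\cdot\rangle_k$ and $\mathrm{prox}^k_{h}(z)$ is the minimizer of $w\mapsto h(w)+\tfrac12\|w-z\|_k^2$. Let $S_*=\operatorname{argmin}_{\mathcal H}(f+g)$. Then: 1. $((f+g)(x_k))_{k}$ is decreasing (i.e. nonincreasing). 2. If $\inf_k(f+g)(x_k)>-\infty$, then $\sum_k\|x_{k+1}-x_k\|^2<+\infty$. 3. If $S_*\ne\varnothing$, then $(x_k)_k$ and $(y_k)_k$ converge weakly to the same point of $S_*$; $(f+g)(y_k)\to\inf_{\mathcal H}(f+g)$; $(f+g)(x_k)\to\inf_{\mathcal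 H}(f+g)$; and $(f+g)(x_k)-\inf_{\mathcal H}(f+g)=o(1/k)$. 4. If $S_*=\varnothing$, then $\|x_k\|\to+\infty$ and $(f+g)(x_k)\to\inf_{\mathcal H}(f+g)$ (which may be $-\infty$). -/

import Mathlib

open Filter Topology Asymptotics
open scoped NNReal ENNReal

noncomputable section

namespace VMFBS

variable {H : Type*} [NormedAddCommGroup H] [InnerProductSpace ℝ H]

/-- The effective domain `{x | h x < +∞}` of an extended-real-valued function. -/
def dom (h : H → EReal) : Set H := {x | h x < ⊤}

/-- Convexity of an extended-real-valued function (used for functions that never equal `-∞`). -/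
def IsConvexFun (h : H → EReal) : Prop :=
  ∀ x y : H, ∀ a b : ℝ, 0 < a → 0 < b → a + b = 1 →
    h (a • x + b • y) ≤ (a : EReal) * h x + (b : EReal) * h y

/-- `h : H → ]-∞, +∞]` is proper, convex and lower semicontinuous. -/
structure IsProperConvexLSC (h : H → EReal) : Prop where
  ne_bot : ∀ x, h x ≠ ⊥
  dom_nonempty : (dom h).Nonempty
  convex : IsConvexFun h
  lsc : LowerSemicontinuous h

/-- The set of minimizers of `h`, i.e. `{x | h x = inf h}`. -/
def argmin (h : H → EReal) : Set H := {x | h x = ⨅ y, h y}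

/-- The squared norm `⟨x, W x⟩` of the scalar product `⟨·, W ·⟩`. -/
def normSq (W : H →L[ℝ] H) (x : H) : ℝ := inner ℝ x (W x)

/-- `inf_{‖x‖ = 1} ⟨x, W x⟩`, the minimum eigenvalue of `W`. -/
def minEig (W : H →L[ℝ] H) : ℝ := ⨅ x : Metric.sphere (0 : H) 1, normSq W (x : H)

/-- `sup_{‖x‖ = 1} ⟨x, W x⟩`, the maximum eigenvalue of `W`. -/
def maxEig (W : H →L[ℝ] H) : ℝ := ⨆ x : Metric.sphere (0 : H) 1, normSq W (x : H)

/-- `h` is Gâteaux differentiable at `x ∈ dom h`, with gradient `u` in the metric `⟨·, W ·⟩`.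
The difference quotients are extended real numbers, and their limit is finite, so `h` is
finite near `x` on every line through `x`. -/
def HasGateauxGradientAt (W : H →L[ℝ] H) (h : H → EReal) (x u : H) : Prop :=
  x ∈ dom h ∧ ∀ d : H,
    Tendsto (fun t : ℝ => (h (x + t • d) - h x) / (t : EReal)) (𝓝[≠] 0)
      (𝓝 ((inner ℝ d (W u) : ℝ) : EReal))

/-- `p` is the proximal point of `z` for `h` in the metric `⟨·, W ·⟩`: it minimizes
`w ↦ h w + (1/2) ‖w - z‖_W ^ 2`. -/
def IsProx (W : H →L[ℝ] H) (h : H → EReal) (z p : H) : Prop :=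
  p ∈ argmin (fun w : H => h w + ((1 / 2 * normSq W (w - z) : ℝ) : EReal))

/-- A sequence of scalar products `⟨·, W k ·⟩`, given by positive operators `W k`, whose norms are
uniformly equivalent to the norm of `H`. -/
def IsMetricSequence (W : ℕ → H →L[ℝ] H) : Prop :=
  (∀ k, (W k).IsPositive) ∧
    ∃ ν μ : ℝ, 0 < ν ∧ ν ≤ μ ∧
      ∀ k x, ν * ‖x‖ ^ 2 ≤ normSq (W k) x ∧ normSq (W k) x ≤ μ * ‖x‖ ^ 2

/-- Almost monotone metrics: `‖·‖²_{k+1} ≤ (1 + η k) ‖·‖²_k` with `η` nonnegative, summable. -/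
def AlmostMonotoneMetrics (W : ℕ → H →L[ℝ] H) : Prop :=
  ∃ η : ℕ → ℝ, (∀ k, 0 ≤ η k) ∧ Summable η ∧
    ∀ k x, normSq (W (k + 1)) x ≤ (1 + η k) * normSq (W k) x

/-- The gaps between the extreme eigenvalues of the metrics are summable. -/
def SummableEigenvalueGaps (W : ℕ → H →L[ℝ] H) : Prop :=
  Summable fun k => maxEig (W k) - minEig (W k)

/-- The variable metric forward-backward iteration with stepsizes `γ` and relaxation parameters
`lam`: `y k = prox^k_{γ k g} (x k - γ k ∇^k f (x k))` and `x (k+1) = x k + lam k (y k - x k)`. -/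
structure IsForwardBackward (W : ℕ → H →L[ℝ] H) (f g : H → EReal) (γ lam : ℕ → ℝ)
    (x y : ℕ → H) : Prop where
  init : x 0 ∈ dom g
  stepsize_pos : ∀ k, 0 < γ k
  relax_pos : ∀ k, 0 < lam k
  relax_le_one : ∀ k, lam k ≤ 1
  forward_backward : ∀ k, ∃ u : H, HasGateauxGradientAt (W k) f (x k) u ∧
    IsProx (W k) (fun w => (γ k : EReal) * g w) (x k - γ k • u) (y k)
  relax : ∀ k, x (k + 1) = x k + lam k • (y k - x k)

/-- Weak convergence of a sequence in `H`. -/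
def WeaklyConverges (x : ℕ → H) (a : H) : Prop :=
  Tendsto (fun k => toWeakSpace ℝ H (x k)) atTop (𝓝 (toWeakSpace ℝ H a))

end VMFBS

end

namespace VMFBS

variable {H : Type*} [NormedAddCommGroup H] [InnerProductSpace ℝ H]

/-! ### Quadratic forms of symmetric operators -/

/-! Write F = f + g. Two inequalities per step carry the proof. Testing the proximal inequality at
`x k`, with the descent lemma applied at `x (k+1)` rather than at `y k`, yields a decrease of F that
controls `‖x (k+1) - x k‖ ^ 2`; the curvature error then only involves `γ k * lam k`
(`sufficient_decrease`). Testing it at an arbitrary w in dom g shows that the squared `W k`-distance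
to w loses a multiple of F(x k) - F(w), up to terms controlled by the decrease of F (`fejer_le`).

Both assumptions on the metrics reduce to one sandwich T (k+1) ≤ r k • W k ≤ T k, with r k bounded
above and away from 0 (`IsMetricSequence.exists_antitone`). Scaling by r k moves the second
inequality to the nonincreasing metrics T k (`exists_quasiFejer`). If F(w) ≤ F(x k) for all k, the
decreases telescope to a summable error, so F(x k) - F(w) is summable and the T k-distances to w
converge.

A point w with F(w) strictly below lim F(x k) would contradict this summability, so F(x k) tends to
inf F whether or not a minimizer exists. Weak cluster points are therefore minimizers. If minimizers
exist, Opial's lemma gives weak convergence, and monotonicity with summability gives the rate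
o(1/k). If none exists, no subsequence can stay bounded. -/

theorem inner_map_comm {W : H →L[ℝ] H} (hW : W.IsPositive) (x y : H) :
    inner ℝ x (W y) = inner ℝ y (W x) := by
  rw [← real_inner_comm]
  exact hW.isSymmetric y x

theorem normSq_nonneg {W : H →L[ℝ] H} (hW : W.IsPositive) (x : H) : 0 ≤ normSq W x :=
  hW.inner_nonneg_right x

theorem normSq_add {W : H →L[ℝ] H} (hW : W.IsPositive) (x y : H) :
    normSq W (x + y) = normSq W x + 2 * inner ℝ y (W x) + normSq W y := by
  simp only [normSq, map_add, inner_add_left, inner_add_right, inner_map_comm hW x y]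
  ring

theorem normSq_smul (W : H →L[ℝ] H) (c : ℝ) (x : H) : normSq W (c • x) = c ^ 2 * normSq W x := by
  simp only [normSq, map_smul, real_inner_smul_left, real_inner_smul_right]
  ring

theorem normSq_id (x : H) : normSq (ContinuousLinearMap.id ℝ H) x = ‖x‖ ^ 2 := by
  simp [normSq]

/-! ### Extended-real-valued convex functions on their domain -/

theorem coe_toReal_of_mem_dom {X : Type*} {h : X → EReal} (hb : ∀ x, h x ≠ ⊥) {x : X}
    (hx : x ∈ dom h) :
    ((h x).toReal : EReal) = h x :=
  EReal.coe_toReal (ne_of_lt hx) (hb x)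

theorem IsConvexFun.combo_le {h : H → EReal} (hc : IsConvexFun h) (hb : ∀ x, h x ≠ ⊥) {x y : H}
    (hx : x ∈ dom h) (hy : y ∈ dom h) {t : ℝ} (h0 : 0 ≤ t) (h1 : t ≤ 1) :
    x + t • (y - x) ∈ dom h ∧
      (h (x + t • (y - x))).toReal ≤ (1 - t) * (h x).toReal + t * (h y).toReal := by
  rcases h0.eq_or_lt with rfl | h0
  · simpa using hx
  rcases h1.eq_or_lt with rfl | h1
  · simpa using hy
  have key := hc x y (1 - t) t (by linarith) h0 (by ring)
  have e : (1 - t) • x + t • y = x + t • (y - x) := by module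
  rw [e, ← coe_toReal_of_mem_dom hb hx, ← coe_toReal_of_mem_dom hb hy] at key
  norm_cast at key
  have hlt : x + t • (y - x) ∈ dom h := lt_of_le_of_lt key (EReal.coe_lt_top _)
  refine ⟨hlt, ?_⟩
  rw [← coe_toReal_of_mem_dom hb hlt] at key
  exact_mod_cast key

/-! ### Gâteaux gradients -/

theorem HasGateauxGradientAt.hasDerivAt {W : H →L[ℝ] H} {h : H → EReal} (hb : ∀ x, h x ≠ ⊥)
    {x u : H} (hg : HasGateauxGradientAt W h x u) (d : H) :
    HasDerivAt (fun t : ℝ => (h (x + t • d)).toReal) (inner ℝ d (W u)) 0 := by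
  obtain ⟨hx, hlim⟩ := hg
  have hlim := hlim d
  rw [hasDerivAt_iff_tendsto_slope]
  have hreal := (EReal.tendsto_toReal (EReal.coe_ne_top _) (EReal.coe_ne_bot _)).comp hlim
  rw [EReal.toReal_coe] at hreal
  refine hreal.congr' ?_
  have h1 := hlim.eventually_ne (EReal.coe_ne_top (inner ℝ d (W u)))
  have h2 := hlim.eventually_ne (EReal.coe_ne_bot (inner ℝ d (W u)))
  filter_upwards [h1, h2, self_mem_nhdsWithin] with t ht1 ht2 ht0
  have ht0 : t ≠ 0 := ht0
  -- An infinite value would make the quotient `⊤` or `⊥` according to the sign of `t`, which is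
  -- excluded near a finite limit.
  have hfin : h (x + t • d) ≠ ⊤ := by
    intro htop
    rw [htop, ← coe_toReal_of_mem_dom hb hx, EReal.top_sub_coe] at ht1 ht2
    rcases lt_or_gt_of_ne ht0 with hneg | hpos
    · exact ht2 (EReal.top_div_of_neg_ne_bot (by exact_mod_cast hneg) (EReal.coe_ne_bot t))
    · exact ht1 (EReal.top_div_of_pos_ne_top (by exact_mod_cast hpos) (EReal.coe_ne_top t))
  simp only [Function.comp, slope_def_field, zero_smul, add_zero, sub_zero]
  rw [← coe_toReal_of_mem_dom hb hx, ← coe_toReal_of_mem_dom hb (lt_top_iff_ne_top.2 hfin),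
    ← EReal.coe_sub, ← EReal.coe_div, EReal.toReal_coe, EReal.toReal_coe, EReal.toReal_coe]

/-- Both sides represent the same directional derivatives. This removes the metric from the linear
term of a forward step. -/
theorem HasGateauxGradientAt.map_eq {W V : H →L[ℝ] H} {h : H → EReal} {x u v : H}
    (hu : HasGateauxGradientAt W h x u) (hv : HasGateauxGradientAt V h x v) : W u = V v := by
  refine ext_inner_left ℝ fun d => ?_
  exact_mod_cast tendsto_nhds_unique (hu.2 d) (hv.2 d)

theorem HasGateauxGradientAt.hasDerivAt_line {W : H →L[ℝ] H} {h : H → EReal} (hb : ∀ x, h x ≠ ⊥)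
    {x d u : H} {t : ℝ} (hg : HasGateauxGradientAt W h (x + t • d) u) :
    HasDerivAt (fun s : ℝ => (h (x + s • d)).toReal) (inner ℝ d (W u)) t := by
  have h0 := hg.hasDerivAt hb d
  have h1 : HasDerivAt (fun s : ℝ => s - t) 1 t := (hasDerivAt_id t).sub_const t
  have h2 := HasDerivAt.comp t (h₂ := fun t' : ℝ => (h (x + t • d + t' • d)).toReal)
    (h := fun s : ℝ => s - t) (by simpa using h0) h1
  refine (by simpa using h2 : HasDerivAt _ _ t).congr_of_eventuallyEq (.of_forall fun s => ?_)
  simp only [Function.comp]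
  congr 2
  module

/-- The gradient inequality of a convex function. -/
theorem HasGateauxGradientAt.le_sub {W : H →L[ℝ] H} {h : H → EReal} (hb : ∀ x, h x ≠ ⊥)
    (hc : IsConvexFun h) {x w u : H} (hg : HasGateauxGradientAt W h x u) (hw : w ∈ dom h) :
    inner ℝ (w - x) (W u) ≤ (h w).toReal - (h x).toReal := by
  have h0 := hg.hasDerivAt hb (w - x)
  rw [hasDerivAt_iff_tendsto_slope] at h0
  have h1 := h0.mono_left (nhdsWithin_mono (0 : ℝ) (s := Set.Ioi 0) fun t ht => ne_of_gt ht)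
  refine le_of_tendsto h1 ?_
  filter_upwards [Ioo_mem_nhdsGT (show (0 : ℝ) < 1 by norm_num)] with t ht
  have := (hc.combo_le hb hg.1 hw ht.1.le ht.2.le).2
  rw [slope_def_field, div_le_iff₀ (by linarith [ht.1])]
  simp only [zero_smul, add_zero, sub_zero]
  linarith

/-- The descent lemma along a segment on which the gradient is Lipschitz continuous. -/
theorem toReal_le_of_lipschitzOn_gradient {f : H → EReal} (hb : ∀ x, f x ≠ ⊥) {s : Set H}
    {gradf : H → H}
    (hgrad : ∀ x ∈ s, HasGateauxGradientAt (ContinuousLinearMap.id ℝ H) f x (gradf x))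
    {L : ℝ≥0} (hLip : LipschitzOnWith L gradf s) {x y : H}
    (hseg : ∀ t : ℝ, 0 ≤ t → t ≤ 1 → x + t • (y - x) ∈ s) :
    (f y).toReal ≤ (f x).toReal + inner ℝ (y - x) (gradf x) + L / 2 * ‖y - x‖ ^ 2 := by
  set d := y - x with hd
  have hder : ∀ t ∈ Set.Icc (0 : ℝ) 1, HasDerivAt
      (fun t : ℝ => (f (x + t • d)).toReal - t * inner ℝ d (gradf x) - t ^ 2 * (L / 2 * ‖d‖ ^ 2))
      (inner ℝ d (gradf (x + t • d)) - 1 * inner ℝ d (gradf x)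
        - (2 : ℕ) * t ^ 1 * (L / 2 * ‖d‖ ^ 2)) t := by
    intro t ht
    refine (((hgrad _ (hseg t ht.1 ht.2)).hasDerivAt_line hb).sub
      ((hasDerivAt_id t).mul_const _)).sub ((hasDerivAt_pow 2 t).mul_const _)
  -- Subtracting the linear part and the full quadratic bound leaves a function whose derivative is
  -- nonpositive by Cauchy-Schwarz and the Lipschitz estimate; only points of the segment are used.
  have hanti : AntitoneOn
      (fun t : ℝ => (f (x + t • d)).toReal - t * inner ℝ d (gradf x) - t ^ 2 * (L / 2 * ‖d‖ ^ 2))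
      (Set.Icc 0 1) := by
    refine antitoneOn_of_deriv_nonpos (convex_Icc 0 1)
      (fun t ht => (hder t ht).continuousAt.continuousWithinAt)
      (fun t ht => (hder t (interior_subset ht)).differentiableAt.differentiableWithinAt) ?_
    intro t ht
    have ht := interior_subset ht
    rw [(hder t ht).deriv]
    have h1 : inner ℝ d (gradf (x + t • d)) - inner ℝ d (gradf x) ≤ ‖d‖ * (L * (t * ‖d‖)) := by
      rw [← inner_sub_right]
      refine (real_inner_le_norm _ _).trans ?_
      gcongr
      have := hLip.norm_sub_le (hseg t ht.1 ht.2) (by simpa using hseg 0 le_rfl zero_le_one)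
      simpa [norm_smul, abs_of_nonneg ht.1] using this
    push_cast
    nlinarith
  have := hanti (Set.left_mem_Icc.2 zero_le_one) (Set.right_mem_Icc.2 zero_le_one) zero_le_one
  simp only [one_smul, zero_smul, add_zero, hd, add_sub_cancel] at this
  simp only [← hd] at this
  linarith

/-! ### Proximal points -/

theorem nonneg_of_forall_add_sq_nonneg {A B : ℝ}
    (h : ∀ t : ℝ, 0 < t → t ≤ 1 → 0 ≤ t * A + t ^ 2 * B) : 0 ≤ A := by
  have h1 : Tendsto (fun t : ℝ => A + t * B) (𝓝[>] 0) (𝓝 (A + 0 * B)) := by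
    refine Tendsto.mono_left ?_ nhdsWithin_le_nhds
    exact (continuous_const.add (continuous_id.mul continuous_const)).tendsto 0
  rw [zero_mul, add_zero] at h1
  refine ge_of_tendsto h1 ?_
  filter_upwards [Ioo_mem_nhdsGT (show (0 : ℝ) < 1 by norm_num)] with t ht
  have := h t ht.1 ht.2.le
  have h2 : 0 ≤ t * (A + t * B) := by linarith
  exact nonneg_of_mul_nonneg_right h2 ht.1

theorem IsProx.mem_dom {W : H →L[ℝ] H} {g : H → EReal} (hg : IsProperConvexLSC g) {c : ℝ}
    (hc : 0 < c) {z p : H} (hp : IsProx W (fun w => (c : EReal) * g w) z p) : p ∈ dom g := by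
  obtain ⟨w, hw⟩ := hg.dom_nonempty
  have h1 : (c : EReal) * g p + ((1 / 2 * normSq W (p - z) : ℝ) : EReal)
      ≤ (c : EReal) * g w + ((1 / 2 * normSq W (w - z) : ℝ) : EReal) :=
    le_of_eq_of_le hp (iInf_le _ w)
  by_contra hp'
  have : g p = ⊤ := by simpa [dom] using hp'
  rw [this, EReal.mul_top_of_pos (by exact_mod_cast hc), EReal.top_add_coe,
    ← coe_toReal_of_mem_dom hg.ne_bot hw, top_le_iff] at h1
  norm_cast at h1
  exact EReal.coe_ne_top _ h1

/-- The variational characterization of proximal points. -/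
theorem IsProx.le_sub {W : H →L[ℝ] H} (hW : W.IsPositive) {g : H → EReal}
    (hg : IsProperConvexLSC g) {c : ℝ} (hc : 0 < c) {z p : H}
    (hp : IsProx W (fun w => (c : EReal) * g w) z p) {w : H} (hw : w ∈ dom g) :
    inner ℝ (w - p) (W (z - p)) ≤ c * ((g w).toReal - (g p).toReal) := by
  have hpd := hp.mem_dom hg hc
  -- Minimality of `p` is compared with the nearby points `p + t • (w - p)`; the claim is the
  -- first-order term in `t`.
  have key : 0 ≤ c * ((g w).toReal - (g p).toReal) - inner ℝ (w - p) (W (z - p)) := by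
    refine nonneg_of_forall_add_sq_nonneg (B := 1 / 2 * normSq W (w - p)) fun t h0 h1 => ?_
    obtain ⟨hmem, hle⟩ := hg.convex.combo_le hg.ne_bot hpd hw h0.le h1
    have hmin : (c : EReal) * g p + ((1 / 2 * normSq W (p - z) : ℝ) : EReal)
        ≤ (c : EReal) * g (p + t • (w - p))
          + ((1 / 2 * normSq W (p + t • (w - p) - z) : ℝ) : EReal) :=
      le_of_eq_of_le hp (iInf_le _ (p + t • (w - p)))
    rw [← coe_toReal_of_mem_dom hg.ne_bot hpd, ← coe_toReal_of_mem_dom hg.ne_bot hmem] at hmin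
    norm_cast at hmin
    rw [show p + t • (w - p) - z = (p - z) + t • (w - p) by abel, normSq_add hW, normSq_smul,
      real_inner_smul_left] at hmin
    have h2 : inner ℝ (w - p) (W (p - z)) = - inner ℝ (w - p) (W (z - p)) := by
      rw [← inner_neg_right, ← map_neg, neg_sub]
    rw [h2] at hmin
    have := mul_le_mul_of_nonneg_left hle hc.le
    linarith
  linarith

/-! ### One step of the iteration -/

section Step

variable {f g : H → EReal} {W : ℕ → H →L[ℝ] H} {gradf : H → H} {L : ℝ≥0} {γ lam : ℕ → ℝ}
  {x y : ℕ → H}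

theorem IsForwardBackward.y_mem (hxy : IsForwardBackward W f g γ lam x y)
    (hg : IsProperConvexLSC g) (k : ℕ) : y k ∈ dom g := by
  obtain ⟨u, -, hu⟩ := hxy.forward_backward k
  exact hu.mem_dom hg (hxy.stepsize_pos k)

theorem IsForwardBackward.x_mem (hxy : IsForwardBackward W f g γ lam x y)
    (hg : IsProperConvexLSC g) (k : ℕ) : x k ∈ dom g := by
  induction k with
  | zero => exact hxy.init
  | succ k ih =>
    rw [hxy.relax]
    exact (hg.convex.combo_le hg.ne_bot ih (hxy.y_mem hg k) (hxy.relax_pos k).le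
      (hxy.relax_le_one k)).1

/-- The variational inequality defining a forward-backward step, in real terms. -/
theorem IsForwardBackward.prox_le (hxy : IsForwardBackward W f g γ lam x y)
    (hg : IsProperConvexLSC g) (hW : ∀ k, (W k).IsPositive)
    (hgrad : ∀ x ∈ dom g, HasGateauxGradientAt (ContinuousLinearMap.id ℝ H) f x (gradf x))
    (k : ℕ) {w : H} (hw : w ∈ dom g) :
    inner ℝ (w - y k) (W k (x k - y k)) - γ k * inner ℝ (w - y k) (gradf (x k))
      ≤ γ k * ((g w).toReal - (g (y k)).toReal) := by
  obtain ⟨u, hu, hp⟩ := hxy.forward_backward k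
  have hWu : W k u = gradf (x k) := hu.map_eq (hgrad _ (hxy.x_mem hg k))
  have h := hp.le_sub (hW k) hg (hxy.stepsize_pos k) hw
  rwa [sub_right_comm, map_sub, inner_sub_right, map_smul, real_inner_smul_right, hWu] at h

theorem IsForwardBackward.descent (hxy : IsForwardBackward W f g γ lam x y)
    (hf : IsProperConvexLSC f) (hg : IsProperConvexLSC g)
    (hgrad : ∀ x ∈ dom g, HasGateauxGradientAt (ContinuousLinearMap.id ℝ H) f x (gradf x))
    (hLip : LipschitzOnWith L gradf (dom g)) (k : ℕ) {w : H} (hw : w ∈ dom g) :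
    (f w).toReal ≤ (f (x k)).toReal + inner ℝ (w - x k) (gradf (x k))
      + L / 2 * ‖w - x k‖ ^ 2 :=
  toReal_le_of_lipschitzOn_gradient hf.ne_bot hgrad hLip fun _ h0 h1 =>
    (hg.convex.combo_le hg.ne_bot (hxy.x_mem hg k) hw h0 h1).1

/-- The proximal inequality at `x k` is scaled by `lam k`; the descent lemma and the convexity of
`g`, both at `x (k + 1)`, are scaled by `γ k`. The gradient terms cancel, and the curvature term `L
/ 2 * γ k * lam k ^ 2 * ‖y k - x k‖ ^ 2` is absorbed through `hM`. -/
theorem IsForwardBackward.sufficient_decrease (hxy : IsForwardBackward W f g γ lam x y)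
    (hf : IsProperConvexLSC f) (hg : IsProperConvexLSC g) (hW : ∀ k, (W k).IsPositive)
    (hgrad : ∀ x ∈ dom g, HasGateauxGradientAt (ContinuousLinearMap.id ℝ H) f x (gradf x))
    (hLip : LipschitzOnWith L gradf (dom g)) {M : ℝ}
    (hM : ∀ k v, γ k * lam k * ‖v‖ ^ 2 ≤ M * normSq (W k) v) (k : ℕ) :
    (1 - L * M / 2) * (lam k * normSq (W k) (y k - x k))
      ≤ γ k * ((f (x k)).toReal + (g (x k)).toReal
        - ((f (x (k + 1))).toReal + (g (x (k + 1))).toReal)) := by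
  have hx := hxy.x_mem hg k
  have hγ := hxy.stepsize_pos k
  have hl := hxy.relax_pos k
  have hp := hxy.prox_le hg hW hgrad k hx
  have hd := hxy.descent hf hg hgrad hLip k (hxy.x_mem hg (k + 1))
  have hgc := (hg.convex.combo_le hg.ne_bot hx (hxy.y_mem hg k) hl.le (hxy.relax_le_one k)).2
  have hMk := hM k (y k - x k)
  rw [← hxy.relax] at hgc
  have e1 : x (k + 1) - x k = lam k • (y k - x k) := by rw [hxy.relax]; abel
  have e2 : inner ℝ (x k - y k) (gradf (x k)) = - inner ℝ (y k - x k) (gradf (x k)) := by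
    rw [← inner_neg_left, neg_sub]
  have e3 : inner ℝ (x k - y k) (W k (x k - y k)) = normSq (W k) (y k - x k) := by
    rw [← neg_sub (y k) (x k), map_neg, inner_neg_neg]
    rfl
  rw [e1, real_inner_smul_left, norm_smul, Real.norm_of_nonneg hl.le, mul_pow] at hd
  rw [e2, e3] at hp
  have hp' := mul_le_mul_of_nonneg_left hp hl.le
  have hd' := mul_le_mul_of_nonneg_left hd hγ.le
  have hg' := mul_le_mul_of_nonneg_left hgc hγ.le
  have hM' := mul_le_mul_of_nonneg_left hMk (show 0 ≤ L / 2 * lam k by positivity)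
  linarith

/-- The square is expanded and its cross term bounded by the proximal inequality at `w`. The
gradient inequality handles the direction `w - x k`; the descent lemma and convexity of `g` at `x (k
+ 1)` handle `y k - x k`. The curvature term is absorbed because `L * M ≤ 2`. -/
theorem IsForwardBackward.fejer_le (hxy : IsForwardBackward W f g γ lam x y)
    (hf : IsProperConvexLSC f) (hg : IsProperConvexLSC g) (hdom : dom g ⊆ dom f)
    (hW : ∀ k, (W k).IsPositive)
    (hgrad : ∀ x ∈ dom g, HasGateauxGradientAt (ContinuousLinearMap.id ℝ H) f x (gradf x))
    (hLip : LipschitzOnWith L gradf (dom g)) {M : ℝ} (hLM : L * M ≤ 2)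
    (hM : ∀ k v, γ k * lam k * ‖v‖ ^ 2 ≤ M * normSq (W k) v) (k : ℕ) {w : H} (hw : w ∈ dom g) :
    normSq (W k) (x (k + 1) - w) ≤ normSq (W k) (x k - w)
      - 2 * (γ k * lam k) * ((f (x k)).toReal + (g (x k)).toReal
        - ((f w).toReal + (g w).toReal))
      + 2 * γ k * ((f (x k)).toReal + (g (x k)).toReal
        - ((f (x (k + 1))).toReal + (g (x (k + 1))).toReal))
      + lam k ^ 2 * normSq (W k) (y k - x k) := by
  have hx := hxy.x_mem hg k
  have hγ := hxy.stepsize_pos k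
  have hl := hxy.relax_pos k
  have hp := hxy.prox_le hg hW hgrad k hw
  have hd := hxy.descent hf hg hgrad hLip k (hxy.x_mem hg (k + 1))
  have hgc := (hg.convex.combo_le hg.ne_bot hx (hxy.y_mem hg k) hl.le (hxy.relax_le_one k)).2
  have hMk := hM k (y k - x k)
  have hq := normSq_nonneg (hW k) (y k - x k)
  have hgr := (hgrad _ hx).le_sub hf.ne_bot hf.convex (hdom hw)
  rw [ContinuousLinearMap.id_apply] at hgr
  rw [← hxy.relax] at hgc
  have e1 : x (k + 1) - x k = lam k • (y k - x k) := by rw [hxy.relax]; abel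
  have e0 : x (k + 1) - w = (x k - w) + lam k • (y k - x k) := by rw [hxy.relax]; abel
  have e2 : inner ℝ (w - y k) (gradf (x k))
      = inner ℝ (w - x k) (gradf (x k)) - inner ℝ (y k - x k) (gradf (x k)) := by
    rw [← inner_sub_left]
    congr 1
    abel
  have e3 : inner ℝ (w - y k) (W k (x k - y k))
      = inner ℝ (y k - x k) (W k (x k - w)) + normSq (W k) (y k - x k) := by
    rw [normSq, ← inner_add_right, ← map_add, inner_map_comm (hW k),
      show x k - w + (y k - x k) = -(w - y k) by abel, map_neg, inner_neg_right, ← neg_sub (y k) (x k),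
      inner_neg_left]
  rw [e1, real_inner_smul_left, norm_smul, Real.norm_of_nonneg hl.le, mul_pow] at hd
  rw [e2, e3] at hp
  rw [e0, normSq_add (hW k), normSq_smul, real_inner_smul_left]
  have hp' := mul_le_mul_of_nonneg_left hp hl.le
  have hd' := mul_le_mul_of_nonneg_left hd hγ.le
  have hg' := mul_le_mul_of_nonneg_left hgc hγ.le
  have hr' := mul_le_mul_of_nonneg_left hgr (mul_pos hγ hl).le
  have hM' := mul_le_mul_of_nonneg_left hMk (show 0 ≤ L * lam k by positivity)
  have hLq := mul_le_mul_of_nonneg_right hLM (mul_nonneg hl.le hq)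
  linarith

/-- No decrease is available at `y k`, since only `γ k * lam k` is limited, but the excess vanishes
with `y k - x k`. -/
theorem IsForwardBackward.value_y_le (hxy : IsForwardBackward W f g γ lam x y)
    (hf : IsProperConvexLSC f) (hg : IsProperConvexLSC g) (hW : ∀ k, (W k).IsPositive)
    (hgrad : ∀ x ∈ dom g, HasGateauxGradientAt (ContinuousLinearMap.id ℝ H) f x (gradf x))
    (hLip : LipschitzOnWith L gradf (dom g)) (k : ℕ) :
    (f (y k)).toReal + (g (y k)).toReal ≤
      (f (x k)).toReal + (g (x k)).toReal + L / 2 * ‖y k - x k‖ ^ 2 := by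
  have hp := hxy.prox_le hg hW hgrad k (hxy.x_mem hg k)
  have hd := hxy.descent hf hg hgrad hLip k (hxy.y_mem hg k)
  have hq : 0 ≤ inner ℝ (x k - y k) (W k (x k - y k)) := normSq_nonneg (hW k) _
  have e2 : inner ℝ (x k - y k) (gradf (x k)) = - inner ℝ (y k - x k) (gradf (x k)) := by
    rw [← inner_neg_left, neg_sub]
  rw [e2] at hp
  have h : 0 ≤ (g (x k)).toReal - (g (y k)).toReal - inner ℝ (y k - x k) (gradf (x k)) :=
    nonneg_of_mul_nonneg_right (by linarith) (hxy.stepsize_pos k)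
  linarith

end Step

/-! ### Real sequences -/

/-- A nonincreasing summable sequence is `o(1/k)`. -/
theorem tendsto_nat_mul_of_antitone_summable {e : ℕ → ℝ} (ha : Antitone e) (hs : Summable e) :
    Tendsto (fun k : ℕ => (k : ℝ) * e k) atTop (𝓝 0) := by
  have h0 : ∀ k, 0 ≤ e k := fun k => ha.le_of_tendsto hs.tendsto_atTop_zero k
  have hS := hs.hasSum.tendsto_sum_nat
  have hS2 := hS.comp (Nat.tendsto_div_const_atTop (show (2 : ℕ) ≠ 0 by norm_num))
  have hlim := (hS.sub hS2).const_mul 2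
  rw [sub_self, mul_zero] at hlim
  refine squeeze_zero (fun k => mul_nonneg k.cast_nonneg (h0 k)) (fun k => ?_) hlim
  -- The block from `k / 2` to `k` has at least `k / 2` terms, each at least `e k`, and its sum
  -- tends to 0.
  have h1 : ∑ j ∈ Finset.Ico (k / 2) k, e j
      = ∑ j ∈ Finset.range k, e j - ∑ j ∈ Finset.range (k / 2), e j :=
    Finset.sum_Ico_eq_sub _ (Nat.div_le_self k 2)
  have h2 : ((k - k / 2 : ℕ) : ℝ) * e k ≤ ∑ j ∈ Finset.Ico (k / 2) k, e j := by
    have := Finset.card_nsmul_le_sum (Finset.Ico (k / 2) k) e (e k)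
      fun j hj => ha (Finset.mem_Ico.1 hj).2.le
    simpa using this
  have h3 : (k : ℝ) ≤ 2 * ((k - k / 2 : ℕ) : ℝ) := by
    have : k ≤ 2 * (k - k / 2) := by omega
    exact_mod_cast this
  simp only [Function.comp_def]
  rw [← h1]
  nlinarith [mul_le_mul_of_nonneg_right h3 (h0 k)]

/-- A deterministic version of the Robbins-Siegmund lemma. -/
theorem exists_tendsto_and_summable_of_le_add_sub {Z b e : ℕ → ℝ} (hZ : ∀ k, 0 ≤ Z k)
    (hb : Summable b) (hb0 : ∀ k, 0 ≤ b k) (he0 : ∀ k, 0 ≤ e k)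
    (h : ∀ k, Z (k + 1) ≤ Z k + b k - e k) :
    (∃ l, Tendsto Z atTop (𝓝 l)) ∧ Summable e := by
  have hB : ∀ k, ∑ j ∈ Finset.range k, b j ≤ ∑' j, b j :=
    fun k => hb.sum_le_tsum _ fun j _ => hb0 j
  -- Correcting `Z` by the accumulated errors and gains makes it nonincreasing.
  set S : ℕ → ℝ := fun k =>
    Z k - ∑ j ∈ Finset.range k, b j + ∑ j ∈ Finset.range k, e j with hS
  have hanti : Antitone S := antitone_nat_of_succ_le fun k => by
    simp only [hS, Finset.sum_range_succ]
    linarith [h k]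
  have he : Summable e := by
    refine summable_of_sum_range_le (c := Z 0 + ∑' j, b j) he0 fun k => ?_
    have := hanti (Nat.zero_le k)
    simp only [hS, Finset.range_zero, Finset.sum_empty] at this
    linarith [hZ k, hB k]
  refine ⟨?_, he⟩
  have hbdd : BddBelow (Set.range S) := by
    refine ⟨-∑' j, b j, ?_⟩
    rintro _ ⟨k, rfl⟩
    have := Finset.sum_nonneg fun j (_ : j ∈ Finset.range k) => he0 j
    simp only [hS]
    linarith [hZ k, hB k]
  have h1 := ((tendsto_atTop_ciInf hanti hbdd).add hb.hasSum.tendsto_sum_nat).sub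
    he.hasSum.tendsto_sum_nat
  refine ⟨_, h1.congr fun k => ?_⟩
  simp only [hS]
  ring

theorem exists_prod_one_add_bounds {η : ℕ → ℝ} (hη : ∀ k, 0 ≤ η k) (hs : Summable η) :
    ∃ C : ℝ, ∀ k, 1 ≤ ∏ j ∈ Finset.range k, (1 + η j) ∧
      ∏ j ∈ Finset.range k, (1 + η j) ≤ C := by
  refine ⟨Real.exp (∑' j, η j), fun k => ⟨?_, ?_⟩⟩
  · calc (1 : ℝ) = ∏ j ∈ Finset.range k, 1 := by simp
      _ ≤ _ := Finset.prod_le_prod (fun _ _ => zero_le_one) fun j _ => by linarith [hη j]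
  · calc ∏ j ∈ Finset.range k, (1 + η j) ≤ ∏ j ∈ Finset.range k, Real.exp (η j) :=
          Finset.prod_le_prod (fun j _ => by linarith [hη j])
            fun j _ => by linarith [Real.add_one_le_exp (η j)]
      _ = Real.exp (∑ j ∈ Finset.range k, η j) := (Real.exp_sum _ _).symm
      _ ≤ _ := Real.exp_le_exp.2 (hs.sum_le_tsum _ fun j _ => hη j)

/-! ### Monotone sequences of positive operators -/

/-- Nonnegativity of the form at `v - c⁻¹ • A v` gives this. It upgrades convergence of quadratic
forms to strong convergence of operators. -/
theorem norm_apply_sq_le_mul_normSq {A : H →L[ℝ] H} (hA : A.IsPositive) {c : ℝ} (hc : 0 < c)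
    (h : ∀ v, normSq A v ≤ c * ‖v‖ ^ 2) (v : H) : ‖A v‖ ^ 2 ≤ c * normSq A v := by
  have h1 := normSq_nonneg hA (v + (-c⁻¹) • A v)
  rw [normSq_add hA, normSq_smul, real_inner_smul_left, real_inner_self_eq_norm_sq] at h1
  have h2 := mul_le_mul_of_nonneg_left (h (A v)) (sq_nonneg (-c⁻¹))
  have h3 : (-c⁻¹) ^ 2 * (c * ‖A v‖ ^ 2) = c⁻¹ * ‖A v‖ ^ 2 := by field_simp
  have h4 : c⁻¹ * ‖A v‖ ^ 2 ≤ normSq A v := by linarith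
  calc ‖A v‖ ^ 2 = c * (c⁻¹ * ‖A v‖ ^ 2) := by field_simp
    _ ≤ _ := by gcongr

theorem normSq_le_norm_mul (A : H →L[ℝ] H) (v : H) : normSq A v ≤ ‖A‖ * ‖v‖ ^ 2 := by
  refine (real_inner_le_norm _ _).trans ?_
  nlinarith [mul_le_mul_of_nonneg_left (A.le_opNorm v) (norm_nonneg v)]

theorem tendsto_normSq_of_antitone {T : ℕ → H →L[ℝ] H} (hT : ∀ k, (T k).IsPositive)
    (hanti : ∀ v, Antitone fun k => normSq (T k) v) (v : H) :
    Tendsto (fun k => normSq (T k) v) atTop (𝓝 (⨅ k, normSq (T k) v)) :=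
  tendsto_atTop_ciInf (hanti v) ⟨0, by rintro _ ⟨k, rfl⟩; exact normSq_nonneg (hT k) v⟩

/-- A nonincreasing sequence of positive operators converges strongly. -/
theorem exists_tendsto_apply_of_antitone [CompleteSpace H] {T : ℕ → H →L[ℝ] H}
    (hT : ∀ k, (T k).IsPositive) (hanti : ∀ v, Antitone fun k => normSq (T k) v) (v : H) :
    ∃ l, Tendsto (fun k => T k v) atTop (𝓝 l) := by
  set c : ℝ := ‖T 0‖ + 1
  have hc : 0 < c := by positivity
  set s : ℝ := ⨅ k, normSq (T k) v with hs
  have hlim := tendsto_normSq_of_antitone hT hanti v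
  rw [← hs] at hlim
  have hsub : ∀ m n w, normSq (T m - T n) w = normSq (T m) w - normSq (T n) w := fun m n w => by
    simp [normSq, inner_sub_right]
  refine cauchySeq_tendsto_of_complete (cauchySeq_of_le_tendsto_0'
    (fun n => √(c * (normSq (T n) v - s))) (fun m n hmn => ?_) ?_)
  · have hpos : (T m - T n).IsPositive :=
      ⟨(hT m).isSymmetric.sub (hT n).isSymmetric, fun w => by
        have h1 : 0 ≤ normSq (T m - T n) w := by
          rw [hsub]
          exact sub_nonneg.2 (hanti w hmn)
        rw [normSq, real_inner_comm] at h1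
        exact h1⟩
    have hle : ∀ w, normSq (T m - T n) w ≤ c * ‖w‖ ^ 2 := fun w => by
      rw [hsub]
      have h1 := normSq_nonneg (hT n) w
      have h2 := hanti w (Nat.zero_le m)
      have h3 := normSq_le_norm_mul (T 0) w
      simp only [c] at *
      nlinarith [sq_nonneg ‖w‖]
    have h1 := norm_apply_sq_le_mul_normSq hpos hc hle v
    rw [hsub] at h1
    rw [dist_eq_norm]
    refine Real.le_sqrt_of_sq_le (h1.trans ?_)
    have := (hanti v).le_of_tendsto hlim n
    gcongr
  · have h1 := ((hlim.sub_const s).const_mul c).sqrt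
    simpa using h1

/-! ### Weak convergence -/

/-- Bounded sequences converge weakly along ultrafilters. -/
theorem exists_weak_limit_ultrafilter [CompleteSpace H] {x : ℕ → H} (U : Ultrafilter ℕ) {R : ℝ}
    (hR : ∀ᶠ k in (U : Filter ℕ), ‖x k‖ ≤ R) :
    ∃ a : H, ∀ v, Tendsto (fun k => inner ℝ (x k) v) U (𝓝 (inner ℝ a v)) := by
  -- The Riesz isometry transfers the question to the dual, where Banach-Alaoglu applies.
  let ψ : ℕ → WeakDual ℝ H := fun k => StrongDual.toWeakDual (InnerProductSpace.toDual ℝ H (x k))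
  have hcomp := WeakDual.isCompact_closedBall (𝕜 := ℝ) (E := H) 0 R
  obtain ⟨φ, -, hφ⟩ := hcomp.ultrafilter_le_nhds (U.map ψ) (by
    rw [le_principal_iff]
    show ψ ⁻¹' _ ∈ U
    filter_upwards [hR] with k hk
    simpa [ψ] using hk)
  have hφ : Tendsto ψ U (𝓝 φ) := hφ
  refine ⟨(InnerProductSpace.toDual ℝ H).symm (WeakDual.toStrongDual φ), fun v => ?_⟩
  have := (WeakDual.eval_continuous (𝕜 := ℝ) v).continuousAt.tendsto.comp hφ
  rw [InnerProductSpace.toDual_symm_apply]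
  exact this

/-- Closed convex sets are closed under weak limits. -/
theorem mem_of_weak_limit [CompleteSpace H] {ι : Type*} {l : Filter ι} [l.NeBot] {s : Set H}
    (hs : Convex ℝ s) (hs' : IsClosed s) {x : ι → H} {a : H} (hx : ∀ᶠ k in l, x k ∈ s)
    (ha : ∀ v, Tendsto (fun k => inner ℝ (x k) v) l (𝓝 (inner ℝ a v))) : a ∈ s := by
  by_contra h
  obtain ⟨φ, u, h1, h2⟩ := geometric_hahn_banach_closed_point hs hs' h
  have e : ∀ z, φ z = inner ℝ z ((InnerProductSpace.toDual ℝ H).symm φ) := fun z => by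
    rw [real_inner_comm, InnerProductSpace.toDual_symm_apply]
  have h3 : φ a ≤ u := by
    rw [e]
    refine le_of_tendsto (ha _) ?_
    filter_upwards [hx] with k hk
    rw [← e]
    exact (h1 _ hk).le
  linarith

theorem weaklyConverges_of_inner [CompleteSpace H] {x : ℕ → H} {a : H}
    (h : ∀ v, Tendsto (fun k => inner ℝ (x k) v) atTop (𝓝 (inner ℝ a v))) :
    WeaklyConverges x a := by
  refine (WeakBilin.tendsto_iff_forall_eval_tendsto (topDualPairing ℝ H).flip
    (separatingDual_iff_injective.1 inferInstance)).2 fun φ => ?_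
  have e : ∀ z, φ z = inner ℝ z ((InnerProductSpace.toDual ℝ H).symm φ) := fun z => by
    rw [real_inner_comm, InnerProductSpace.toDual_symm_apply]
  have := h ((InnerProductSpace.toDual ℝ H).symm φ)
  simp only [← e] at this
  exact this

/-- Opial's lemma for a nonincreasing sequence of metrics. -/
theorem exists_weak_limit_of_quasiFejer [CompleteSpace H] {T : ℕ → H →L[ℝ] H}
    (hT : ∀ k, (T k).IsPositive) (hanti : ∀ v, Antitone fun k => normSq (T k) v) {c : ℝ}
    (hc : 0 < c) (hTc : ∀ k v, c * ‖v‖ ^ 2 ≤ normSq (T k) v) {x : ℕ → H} {S : Set H}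
    (hS : S.Nonempty) (hlim : ∀ w ∈ S, ∃ l, Tendsto (fun k => normSq (T k) (x k - w)) atTop (𝓝 l))
    (hclus : ∀ (U : Ultrafilter ℕ) (a : H), (U : Filter ℕ) ≤ atTop →
      (∀ v, Tendsto (fun k => inner ℝ (x k) v) U (𝓝 (inner ℝ a v))) → a ∈ S) :
    ∃ a ∈ S, ∀ v, Tendsto (fun k => inner ℝ (x k) v) atTop (𝓝 (inner ℝ a v)) := by
  obtain ⟨R, hR⟩ : ∃ R, ∀ k, ‖x k‖ ≤ R := by
    obtain ⟨w, hw⟩ := hS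
    obtain ⟨l, hl⟩ := hlim w hw
    obtain ⟨B, hB⟩ := hl.bddAbove_range
    refine ⟨√(B / c) + ‖w‖, fun k => ?_⟩
    have h1 : c * ‖x k - w‖ ^ 2 ≤ B := (hTc k _).trans (hB ⟨k, rfl⟩)
    have h2 : ‖x k - w‖ ≤ √(B / c) := Real.le_sqrt_of_sq_le (by
      rw [le_div_iff₀ hc]
      linarith)
    calc ‖x k‖ = ‖(x k - w) + w‖ := by rw [sub_add_cancel]
      _ ≤ _ := (norm_add_le _ _).trans (by linarith)
  -- In the expansion of the square around `b`, the cross term pairs the bounded, weakly null `x k -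
  -- b` with the strongly convergent `T k (b - a)`, so it vanishes.
  have key : ∀ (U : Ultrafilter ℕ) (a b : H) (l : ℝ), (U : Filter ℕ) ≤ atTop →
      (∀ v, Tendsto (fun k => inner ℝ (x k) v) U (𝓝 (inner ℝ b v))) →
      Tendsto (fun k => normSq (T k) (x k - a) - normSq (T k) (x k - b)) U (𝓝 l) →
      l = ⨅ k, normSq (T k) (b - a) := by
    intro U a b l hU hb hl
    obtain ⟨z, hz⟩ := exists_tendsto_apply_of_antitone hT hanti (b - a)
    have h1 : Tendsto (fun k => inner ℝ (x k - b) (T k (b - a) - z)) U (𝓝 0) := by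
      have h2 : Tendsto (fun k => (R + ‖b‖) * ‖T k (b - a) - z‖) U (𝓝 0) := by
        have := ((tendsto_iff_norm_sub_tendsto_zero.1 hz).const_mul (R + ‖b‖)).mono_left hU
        simpa using this
      refine squeeze_zero_norm (fun k => (norm_inner_le_norm _ _).trans ?_) h2
      gcongr
      exact (norm_sub_le _ _).trans (by linarith [hR k])
    have h2 : Tendsto (fun k => inner ℝ (x k - b) z) U (𝓝 0) := by
      have := (hb z).sub_const (inner ℝ b z)
      simpa [inner_sub_left] using this
    have h3 := ((tendsto_normSq_of_antitone hT hanti (b - a)).mono_left hU).add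
      ((h1.add h2).const_mul 2)
    rw [add_zero, mul_zero, add_zero] at h3
    refine tendsto_nhds_unique hl (h3.congr fun k => ?_)
    rw [show x k - a = (b - a) + (x k - b) by abel, normSq_add (hT k), inner_sub_right]
    ring
  have hlimU : ∀ U : Ultrafilter ℕ, (U : Filter ℕ) ≤ atTop → ∃ a ∈ S,
      ∀ v, Tendsto (fun k => inner ℝ (x k) v) U (𝓝 (inner ℝ a v)) := fun U hU => by
    obtain ⟨a, ha⟩ := exists_weak_limit_ultrafilter U (.of_forall hR)
    exact ⟨a, hclus U a hU ha, ha⟩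
  have hU0 : ((Ultrafilter.of atTop : Ultrafilter ℕ) : Filter ℕ) ≤ atTop := Ultrafilter.of_le _
  obtain ⟨a, haS, ha⟩ := hlimU _ hU0
  refine ⟨a, haS, fun v => tendsto_iff_ultrafilter _ _ _ |>.2 fun U hU => ?_⟩
  obtain ⟨b, hbS, hb⟩ := hlimU U hU
  obtain ⟨la, hla⟩ := hlim a haS
  obtain ⟨lb, hlb⟩ := hlim b hbS
  -- Exchanging the two cluster points gives `la - lb` and `lb - la` the same nonnegative value,
  -- hence 0.
  have h1 := key U a b _ hU hb ((hla.sub hlb).mono_left hU)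
  have h2 := key _ b a _ hU0 ha ((hlb.sub hla).mono_left hU0)
  have h3 : ∀ k, normSq (T k) (a - b) = normSq (T k) (b - a) := fun k => by
    rw [← neg_sub b a, ← neg_one_smul ℝ, normSq_smul]
    norm_num
  simp only [h3] at h2
  have h4 : c * ‖b - a‖ ^ 2 ≤ ⨅ k, normSq (T k) (b - a) := le_ciInf fun k => hTc k _
  have h5 : ‖b - a‖ ^ 2 ≤ 0 := by
    by_contra h
    have := mul_pos hc (not_le.1 h)
    linarith
  have h6 : b = a := sub_eq_zero.1 (norm_eq_zero.1 (pow_eq_zero_iff two_ne_zero |>.1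
    (le_antisymm h5 (sq_nonneg _))))
  exact h6 ▸ hb v

/-! ### Extreme eigenvalues -/

theorem normSq_eq_unit (W : H →L[ℝ] H) {v : H} (hv : v ≠ 0) :
    ∃ e : Metric.sphere (0 : H) 1, normSq W v = normSq W (e : H) * ‖v‖ ^ 2 := by
  have h : ‖v‖ ≠ 0 := norm_ne_zero_iff.2 hv
  refine ⟨⟨‖v‖⁻¹ • v, by simp [norm_smul, h]⟩, ?_⟩
  simp only [normSq_smul]
  field_simp

theorem minEig_mul_le {W : H →L[ℝ] H} (hW : W.IsPositive) (v : H) :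
    minEig W * ‖v‖ ^ 2 ≤ normSq W v := by
  rcases eq_or_ne v 0 with rfl | hv
  · simp [normSq]
  · obtain ⟨e, he⟩ := normSq_eq_unit W hv
    rw [he]
    gcongr
    exact ciInf_le ⟨0, by rintro _ ⟨k, rfl⟩; exact normSq_nonneg hW _⟩ e

theorem le_maxEig_mul (W : H →L[ℝ] H) (v : H) : normSq W v ≤ maxEig W * ‖v‖ ^ 2 := by
  rcases eq_or_ne v 0 with rfl | hv
  · simp [normSq]
  · obtain ⟨e, he⟩ := normSq_eq_unit W hv
    rw [he]
    gcongr
    refine le_ciSup (f := fun x : Metric.sphere (0 : H) 1 => normSq W (x : H)) ⟨‖W‖, ?_⟩ e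
    rintro _ ⟨k, rfl⟩
    simpa using normSq_le_norm_mul W (k : H)

theorem le_minEig [Nontrivial H] {W : H →L[ℝ] H} {ν : ℝ}
    (h : ∀ v, ν * ‖v‖ ^ 2 ≤ normSq W v) : ν ≤ minEig W := by
  have : Nonempty (Metric.sphere (0 : H) 1) :=
    (NormedSpace.sphere_nonempty.2 zero_le_one).to_subtype
  refine le_ciInf fun e => ?_
  simpa using h (e : H)

theorem minEig_le [Nontrivial H] {W : H →L[ℝ] H} (hW : W.IsPositive) {μ : ℝ}
    (h : ∀ v, normSq W v ≤ μ * ‖v‖ ^ 2) : minEig W ≤ μ := by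
  obtain ⟨v, hv⟩ := exists_ne (0 : H)
  exact le_of_mul_le_mul_right ((minEig_mul_le hW v).trans (h v))
    (by have := norm_pos_iff.2 hv; positivity)

theorem minEig_le_maxEig [Nontrivial H] {W : H →L[ℝ] H} (hW : W.IsPositive) :
    minEig W ≤ maxEig W :=
  minEig_le hW (le_maxEig_mul W)

/-! ### Comparison with a nonincreasing sequence of metrics -/

/-- With τ k the product of the `1 + η j` for j < k, almost monotone metrics allow T k = (τ k)⁻¹ • W
k. For summable gaps, T k = (τ k)⁻¹ • id with `1 + η k = maxEig (W k) / minEig (W k)`. -/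
theorem IsMetricSequence.exists_antitone {W : ℕ → H →L[ℝ] H} (hW : IsMetricSequence W)
    (hm : AlmostMonotoneMetrics W ∨ SummableEigenvalueGaps W) :
    ∃ (T : ℕ → H →L[ℝ] H) (r : ℕ → ℝ) (c C : ℝ), (∀ k, (T k).IsPositive) ∧ 0 < c ∧
      (∀ k, c ≤ r k ∧ r k ≤ C) ∧ (∀ k v, c * ‖v‖ ^ 2 ≤ normSq (T k) v) ∧
      ∀ k v, normSq (T (k + 1)) v ≤ r k * normSq (W k) v ∧
        r k * normSq (W k) v ≤ normSq (T k) v := by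
  obtain ⟨hpos, ν, μ, hν, hνμ, hb⟩ := hW
  have hsmul : ∀ {A : H →L[ℝ] H} {a : ℝ}, A.IsPositive → 0 ≤ a → (a • A).IsPositive :=
    fun hA ha => hA.smul_of_nonneg ha
  have hns : ∀ (a : ℝ) (A : H →L[ℝ] H) v, normSq (a • A) v = a * normSq A v := fun a A v => by
    simp [normSq, real_inner_smul_right]
  rcases hm with ⟨η, hη, hs, hmon⟩ | hs
  · obtain ⟨C, hC⟩ := exists_prod_one_add_bounds hη hs
    set τ : ℕ → ℝ := fun k => ∏ j ∈ Finset.range k, (1 + η j) with hτ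
    have hτ0 : ∀ k, 0 < τ k := fun k => lt_of_lt_of_le one_pos (hC k).1
    have hC0 : 0 < C := lt_of_lt_of_le (hτ0 0) (hC 0).2
    have hτs : ∀ k, τ (k + 1) = τ k * (1 + η k) := fun k => Finset.prod_range_succ _ _
    have hτC : ∀ k, C⁻¹ ≤ (τ k)⁻¹ := fun k => inv_anti₀ (hτ0 k) (hC k).2
    refine ⟨fun k => (τ k)⁻¹ • W k, fun k => (τ k)⁻¹, min C⁻¹ (C⁻¹ * ν), 1,
      fun k => hsmul (hpos k) (inv_nonneg.2 (hτ0 k).le), by positivity,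
      fun k => ⟨(min_le_left _ _).trans (hτC k), inv_le_one_of_one_le₀ (hC k).1⟩, ?_, ?_⟩
    · intro k v
      rw [hns]
      calc min C⁻¹ (C⁻¹ * ν) * ‖v‖ ^ 2 ≤ C⁻¹ * ν * ‖v‖ ^ 2 := by gcongr; exact min_le_right _ _
        _ = C⁻¹ * (ν * ‖v‖ ^ 2) := by ring
        _ ≤ _ := mul_le_mul (hτC k) ((hb k v).1) (by positivity) (inv_nonneg.2 (hτ0 k).le)
    · intro k v
      simp only [hns]
      refine ⟨?_, le_rfl⟩
      have h1 : 0 < 1 + η k := by linarith [hη k]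
      have := hτ0 k
      rw [hτs, mul_inv, mul_assoc]
      gcongr
      rw [inv_mul_le_iff₀ h1]
      exact hmon k v
  · rcases subsingleton_or_nontrivial H with hH | hH
    -- On the zero space the unit sphere is empty and `minEig` carries no information.
    · refine ⟨fun _ => ContinuousLinearMap.id ℝ H, fun _ => 1, 1, 1, fun _ => ContinuousLinearMap.isPositive_one, one_pos,
        fun _ => ⟨le_rfl, le_rfl⟩, fun k v => ?_, fun k v => ?_⟩ <;>
      simp [Subsingleton.elim v 0, normSq]
    have hm1 : ∀ k, ν ≤ minEig (W k) := fun k => le_minEig fun v => (hb k v).1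
    have hm2 : ∀ k, minEig (W k) ≤ μ := fun k => minEig_le (hpos k) fun v => (hb k v).2
    have hm0 : ∀ k, 0 < minEig (W k) := fun k => hν.trans_le (hm1 k)
    set η : ℕ → ℝ := fun k => (maxEig (W k) - minEig (W k)) / minEig (W k) with hηd
    have hgap : ∀ k, 0 ≤ maxEig (W k) - minEig (W k) := fun k =>
      sub_nonneg.2 (minEig_le_maxEig (hpos k))
    have hη : ∀ k, 0 ≤ η k := fun k => div_nonneg (hgap k) (hm0 k).le
    have hηs : Summable η := by
      refine Summable.of_nonneg_of_le hη (fun k => ?_) (hs.div_const ν)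
      exact div_le_div_of_nonneg_left (hgap k) hν (hm1 k)
    obtain ⟨C, hC⟩ := exists_prod_one_add_bounds hη hηs
    set τ : ℕ → ℝ := fun k => ∏ j ∈ Finset.range k, (1 + η j) with hτ
    have hτ0 : ∀ k, 0 < τ k := fun k => lt_of_lt_of_le one_pos (hC k).1
    have hC0 : 0 < C := lt_of_lt_of_le (hτ0 0) (hC 0).2
    have hμ : 0 < μ := hν.trans_le hνμ
    have hτs : ∀ k, τ (k + 1) * minEig (W k) = τ k * maxEig (W k) := fun k => by
      have h1 : 1 + η k = maxEig (W k) / minEig (W k) := by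
        simp only [hηd]
        rw [sub_div, div_self (hm0 k).ne']
        ring
      have h2 : τ (k + 1) = τ k * (1 + η k) := Finset.prod_range_succ _ _
      rw [h2, h1, mul_assoc, div_mul_cancel₀ _ (hm0 k).ne']
    have hτC : ∀ k, C⁻¹ ≤ (τ k)⁻¹ := fun k => inv_anti₀ (hτ0 k) (hC k).2
    have hM0 : ∀ k, 0 < maxEig (W k) := fun k => by linarith [hm0 k, hgap k]
    -- The factor `(τ (k + 1) * minEig (W k))⁻¹` also equals `(τ k * maxEig (W k))⁻¹` by `hτs`; each
    -- form gives one side of the sandwich.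
    refine ⟨fun k => (τ k)⁻¹ • ContinuousLinearMap.id ℝ H,
      fun k => (τ (k + 1) * minEig (W k))⁻¹, min C⁻¹ (C * μ)⁻¹, ν⁻¹,
      fun k => hsmul ContinuousLinearMap.isPositive_one (inv_nonneg.2 (hτ0 k).le), by positivity,
      fun k => ⟨(min_le_right _ _).trans ?_, ?_⟩, ?_, ?_⟩
    · refine inv_anti₀ (mul_pos (hτ0 _) (hm0 _)) ?_
      exact mul_le_mul (hC _).2 (hm2 k) (hm0 k).le hC0.le
    · refine inv_anti₀ hν ?_
      nlinarith [(hC (k + 1)).1, hm1 k]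
    · intro k v
      rw [hns, normSq_id]
      gcongr
      exact (min_le_left _ _).trans (hτC k)
    · intro k v
      simp only [hns, normSq_id]
      constructor
      · rw [mul_inv, mul_assoc]
        have := hτ0 (k + 1)
        gcongr
        rw [inv_mul_eq_div, le_div_iff₀ (hm0 k), mul_comm]
        exact minEig_mul_le (hpos k) v
      · rw [hτs, mul_inv, mul_assoc]
        have := hτ0 k
        gcongr
        rw [inv_mul_le_iff₀ (hM0 k)]
        exact le_maxEig_mul _ v

/-! ### The stepsize bound -/

theorem exists_stepsize_bound {W : ℕ → H →L[ℝ] H} (hW : IsMetricSequence W) {L : ℝ≥0}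
    {γ lam : ℕ → ℝ}
    (hstep : ⨆ k, ENNReal.ofReal (γ k * lam k / minEig (W k)) < 2 / (L : ℝ≥0∞)) :
    ∃ M : ℝ, 0 < M ∧ L * M < 2 ∧ ∀ k v, γ k * lam k * ‖v‖ ^ 2 ≤ M * normSq (W k) v := by
  obtain ⟨hpos, ν, μ, hν, hνμ, hb⟩ := hW
  -- A value strictly between the two sides is finite and positive even when `L = 0`.
  obtain ⟨m, hm1, hm2⟩ := exists_between hstep
  have hm0 : 0 < m := lt_of_le_of_lt (zero_le) hm1
  have hmt : m ≠ ⊤ := ne_top_of_lt hm2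
  refine ⟨m.toReal, ENNReal.toReal_pos hm0.ne' hmt, ?_, fun k v => ?_⟩
  · have h1 : m * L < 2 := ENNReal.mul_lt_of_lt_div hm2
    have h2 := (ENNReal.toReal_lt_toReal (ENNReal.mul_ne_top hmt ENNReal.coe_ne_top)
      ENNReal.ofNat_ne_top).2 h1
    rw [ENNReal.toReal_mul, mul_comm] at h2
    simpa using h2
  · rcases eq_or_ne v 0 with rfl | hv
    · simp [normSq]
    have : Nontrivial H := ⟨v, 0, hv⟩
    have hmin : 0 < minEig (W k) := hν.trans_le (le_minEig fun v => (hb k v).1)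
    have h1 : ENNReal.ofReal (γ k * lam k / minEig (W k)) ≤ m :=
      (le_iSup (fun k => ENNReal.ofReal (γ k * lam k / minEig (W k))) k).trans hm1.le
    rw [ENNReal.ofReal_le_iff_le_toReal hmt, div_le_iff₀ hmin] at h1
    calc γ k * lam k * ‖v‖ ^ 2 ≤ m.toReal * minEig (W k) * ‖v‖ ^ 2 := by gcongr
      _ = m.toReal * (minEig (W k) * ‖v‖ ^ 2) := by ring
      _ ≤ _ := by gcongr; exact minEig_mul_le (hpos k) v

/-! ### Sums of extended-real-valued convex functions -/

section Sum

variable {f g : H → EReal}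

theorem add_eq_coe (hf : IsProperConvexLSC f) (hg : IsProperConvexLSC g) (hdom : dom g ⊆ dom f)
    {z : H} (hz : z ∈ dom g) :
    f z + g z = (((f z).toReal + (g z).toReal : ℝ) : EReal) := by
  rw [EReal.coe_add, coe_toReal_of_mem_dom hf.ne_bot (hdom hz), coe_toReal_of_mem_dom hg.ne_bot hz]

theorem mem_dom_of_add_lt_top (hf : IsProperConvexLSC f) {z : H} (h : f z + g z < ⊤) :
    z ∈ dom g := by
  by_contra hz
  have : g z = ⊤ := by simpa [dom] using hz
  rw [this, EReal.add_top_of_ne_bot (hf.ne_bot z)] at h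
  exact lt_irrefl _ h

theorem convex_sublevel_add (hf : IsProperConvexLSC f) (hg : IsProperConvexLSC g)
    (hdom : dom g ⊆ dom f) (r : ℝ) : Convex ℝ {z | f z + g z ≤ (r : EReal)} := by
  rw [convex_iff_forall_pos]
  intro z hz w hw a b ha hb hab
  have hz' := mem_dom_of_add_lt_top hf (lt_of_le_of_lt hz (EReal.coe_lt_top r))
  have hw' := mem_dom_of_add_lt_top hf (lt_of_le_of_lt hw (EReal.coe_lt_top r))
  have e : a • z + b • w = z + b • (w - z) := by
    rw [← eq_sub_iff_add_eq] at hab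
    subst hab
    module
  have h1 := hg.convex.combo_le hg.ne_bot hz' hw' hb.le (by linarith)
  have h2 := hf.convex.combo_le hf.ne_bot (hdom hz') (hdom hw') hb.le (by linarith)
  simp only [Set.mem_ofPred_eq] at hz hw ⊢
  rw [e, add_eq_coe hf hg hdom h1.1]
  rw [add_eq_coe hf hg hdom hz'] at hz
  rw [add_eq_coe hf hg hdom hw'] at hw
  norm_cast at hz hw ⊢
  nlinarith [h1.2, h2.2]

theorem isClosed_sublevel_add (hf : IsProperConvexLSC f) (hg : IsProperConvexLSC g) (r : EReal) :
    IsClosed {z | f z + g z ≤ r} := by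
  have : LowerSemicontinuous fun z => f z + g z :=
    hf.lsc.add' hg.lsc fun z =>
      EReal.continuousAt_add (Or.inr (hg.ne_bot z)) (Or.inl (hf.ne_bot z))
  exact this.isClosed_preimage r

/-- Weak limits of minimizing sequences are minimizers. -/
theorem mem_argmin_of_weak_limit [CompleteSpace H] (hf : IsProperConvexLSC f)
    (hg : IsProperConvexLSC g) (hdom : dom g ⊆ dom f) {ι : Type*} {l : Filter ι} [l.NeBot]
    {x : ι → H} {a : H}
    (hx : Tendsto (fun k => f (x k) + g (x k)) l (𝓝 (⨅ z, (f z + g z))))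
    (ha : ∀ v, Tendsto (fun k => inner ℝ (x k) v) l (𝓝 (inner ℝ a v))) :
    a ∈ argmin (fun z => f z + g z) := by
  refine le_antisymm (EReal.le_of_forall_lt_iff_le.1 fun r hr => ?_) (iInf_le _ a)
  refine mem_of_weak_limit (convex_sublevel_add hf hg hdom r) (isClosed_sublevel_add hf hg r) ?_ ha
  filter_upwards [hx.eventually_lt_const hr] with k hk using hk.le

end Sum

/-! ### Convergence of the iteration -/

section Convergence

variable {f g : H → EReal} {W : ℕ → H →L[ℝ] H} {gradf : H → H} {L : ℝ≥0} {γ lam : ℕ → ℝ}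
  {x y : ℕ → H}

/-- The factor `γ k` appears on both sides after using `hM` and cancels, so the constant is uniform
in `k`. -/
theorem IsForwardBackward.exists_sq_step_le (hxy : IsForwardBackward W f g γ lam x y)
    (hf : IsProperConvexLSC f) (hg : IsProperConvexLSC g) (hW : ∀ k, (W k).IsPositive)
    (hgrad : ∀ x ∈ dom g, HasGateauxGradientAt (ContinuousLinearMap.id ℝ H) f x (gradf x))
    (hLip : LipschitzOnWith L gradf (dom g)) {M : ℝ} (hM0 : 0 < M) (hLM : L * M < 2)
    (hM : ∀ k v, γ k * lam k * ‖v‖ ^ 2 ≤ M * normSq (W k) v) :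
    ∃ C : ℝ, 0 < C ∧ ∀ k, ‖x (k + 1) - x k‖ ^ 2 ≤ C * ((f (x k)).toReal + (g (x k)).toReal
        - ((f (x (k + 1))).toReal + (g (x (k + 1))).toReal)) := by
  have hδ : 0 < 1 - L * M / 2 := by linarith
  refine ⟨M / (1 - L * M / 2), by positivity, fun k => ?_⟩
  have h1 := hxy.sufficient_decrease hf hg hW hgrad hLip hM k
  have hl := hxy.relax_pos k
  have hγ := hxy.stepsize_pos k
  have h2 := mul_le_mul_of_nonneg_left (hM k (y k - x k)) (mul_pos hδ hl).le
  have h3 := mul_le_mul_of_nonneg_left h1 hM0.le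
  have e1 : x (k + 1) - x k = lam k • (y k - x k) := by rw [hxy.relax]; abel
  rw [e1, norm_smul, Real.norm_of_nonneg hl.le, mul_pow, div_mul_eq_mul_div, le_div_iff₀ hδ]
  refine le_of_mul_le_mul_left ?_ hγ
  linarith

theorem IsForwardBackward.antitone_toReal (hxy : IsForwardBackward W f g γ lam x y)
    (hf : IsProperConvexLSC f) (hg : IsProperConvexLSC g) (hW : ∀ k, (W k).IsPositive)
    (hgrad : ∀ x ∈ dom g, HasGateauxGradientAt (ContinuousLinearMap.id ℝ H) f x (gradf x))
    (hLip : LipschitzOnWith L gradf (dom g)) {M : ℝ} (hM0 : 0 < M) (hLM : L * M < 2)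
    (hM : ∀ k v, γ k * lam k * ‖v‖ ^ 2 ≤ M * normSq (W k) v) :
    Antitone fun k => (f (x k)).toReal + (g (x k)).toReal := by
  obtain ⟨C, hC, h⟩ := hxy.exists_sq_step_le hf hg hW hgrad hLip hM0 hLM hM
  refine antitone_nat_of_succ_le fun k => ?_
  exact sub_nonneg.1 (nonneg_of_mul_nonneg_right ((sq_nonneg _).trans (h k)) hC)

/-- In a suitable nonincreasing sequence of metrics, the iterates are quasi-Fejér monotone with
respect to every point whose value lies below all values of the sequence. -/
theorem IsForwardBackward.exists_quasiFejer (hxy : IsForwardBackward W f g γ lam x y)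
    (hf : IsProperConvexLSC f) (hg : IsProperConvexLSC g) (hdom : dom g ⊆ dom f)
    (hW : IsMetricSequence W) (hm : AlmostMonotoneMetrics W ∨ SummableEigenvalueGaps W)
    (hgrad : ∀ x ∈ dom g, HasGateauxGradientAt (ContinuousLinearMap.id ℝ H) f x (gradf x))
    (hLip : LipschitzOnWith L gradf (dom g)) {M : ℝ} (hM0 : 0 < M) (hLM : L * M < 2)
    (hM : ∀ k v, γ k * lam k * ‖v‖ ^ 2 ≤ M * normSq (W k) v)
    {l₀ γ₀ : ℝ} (hl₀ : 0 < l₀) (hl : ∀ k, l₀ ≤ lam k) (hγ₀ : 0 < γ₀) (hγ : ∀ k, γ₀ ≤ γ k) :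
    ∃ (T : ℕ → H →L[ℝ] H) (c C : ℝ), (∀ k, (T k).IsPositive) ∧
      (∀ v, Antitone fun k => normSq (T k) v) ∧ 0 < c ∧ 0 ≤ C ∧
      (∀ k v, c * ‖v‖ ^ 2 ≤ normSq (T k) v) ∧
      ∀ k, ∀ w ∈ dom g, (f w).toReal + (g w).toReal ≤ (f (x k)).toReal + (g (x k)).toReal →
        normSq (T (k + 1)) (x (k + 1) - w) ≤ normSq (T k) (x k - w)
          + C * ((f (x k)).toReal + (g (x k)).toReal
            - ((f (x (k + 1))).toReal + (g (x (k + 1))).toReal))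
          - c * ((f (x k)).toReal + (g (x k)).toReal - ((f w).toReal + (g w).toReal)) := by
  obtain ⟨T, r, c, C, hT, hc, hr, hTc, hTW⟩ := hW.exists_antitone hm
  obtain ⟨hpos, ν, μ, hν, hνμ, hb⟩ := hW
  obtain ⟨C₁, hC₁, hstep⟩ := hxy.exists_sq_step_le hf hg hpos hgrad hLip hM0 hLM hM
  have hdec := hxy.antitone_toReal hf hg hpos hgrad hLip hM0 hLM hM
  have hμ : 0 < μ := hν.trans_le hνμ
  have hC0 : 0 < C := hc.trans_le ((hr 0).1.trans (hr 0).2)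
  -- The stepsizes are bounded above because `γ k * lam k ≤ M * μ` and `l₀ ≤ lam k`; on the zero
  -- space the iterates do not move.
  have hγa : ∀ k, γ k * ((f (x k)).toReal + (g (x k)).toReal
      - ((f (x (k + 1))).toReal + (g (x (k + 1))).toReal)) ≤ M * μ / l₀ *
      ((f (x k)).toReal + (g (x k)).toReal
      - ((f (x (k + 1))).toReal + (g (x (k + 1))).toReal)) := by
    intro k
    rcases subsingleton_or_nontrivial H with hH | hH
    · rw [Subsingleton.elim (x (k + 1)) (x k), sub_self, mul_zero, mul_zero]
    · refine mul_le_mul_of_nonneg_right ?_ (sub_nonneg.2 (hdec (Nat.le_succ k)))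
      obtain ⟨v, hv⟩ := exists_ne (0 : H)
      have hv' : 0 < ‖v‖ ^ 2 := by have := norm_pos_iff.2 hv; positivity
      have h1 : γ k * lam k * ‖v‖ ^ 2 ≤ M * μ * ‖v‖ ^ 2 := by
        refine (hM k v).trans ?_
        rw [mul_assoc]
        gcongr
        exact (hb k v).2
      have h2 := le_of_mul_le_mul_right h1 hv'
      rw [le_div_iff₀ hl₀]
      exact (mul_le_mul_of_nonneg_left (hl k) (hxy.stepsize_pos k).le).trans h2
  -- One constant serves both as coercivity bound for `T` and as coefficient of the value gap.
  set c' : ℝ := min c (c * (2 * (γ₀ * l₀))) with hc'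
  have hc'0 : 0 < c' := by positivity
  refine ⟨T, c', C * (2 * (M * μ / l₀) + μ * C₁), hT,
    fun v => antitone_nat_of_succ_le fun k => (hTW k v).1.trans (hTW k v).2, hc'0,
    by positivity, fun k v => (mul_le_mul_of_nonneg_right (min_le_left _ _) (sq_nonneg _)).trans
      (hTc k v), fun k w hw hle => ?_⟩
  have hfe := hxy.fejer_le hf hg hdom hpos hgrad hLip hLM.le hM k hw
  have hγk := hγa k
  have hst := hstep k
  have hbk := (hb k (x (k + 1) - x k)).2
  have hr0 : 0 < r k := hc.trans_le (hr k).1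
  have e1 : x (k + 1) - x k = lam k • (y k - x k) := by rw [hxy.relax]; abel
  rw [← normSq_smul, ← e1] at hfe
  have ha0 := sub_nonneg.2 (hdec (Nat.le_succ k))
  have he0 := sub_nonneg.2 hle
  simp only [Nat.succ_eq_add_one] at ha0
  set a := (f (x k)).toReal + (g (x k)).toReal
      - ((f (x (k + 1))).toReal + (g (x (k + 1))).toReal)
  set e := (f (x k)).toReal + (g (x k)).toReal - ((f w).toReal + (g w).toReal)
  have h1 : normSq (W k) (x (k + 1) - x k) ≤ μ * (C₁ * a) := hbk.trans (by gcongr)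
  have h2 : γ₀ * l₀ ≤ γ k * lam k :=
    mul_le_mul (hγ k) (hl k) hl₀.le (hxy.stepsize_pos k).le
  have h3 : normSq (W k) (x (k + 1) - w) ≤ normSq (W k) (x k - w)
      + (2 * (M * μ / l₀) + μ * C₁) * a - 2 * (γ₀ * l₀) * e := by
    have := mul_le_mul_of_nonneg_right h2 he0
    linarith
  have h4 := mul_le_mul_of_nonneg_left h3 hr0.le
  have h5 : r k * ((2 * (M * μ / l₀) + μ * C₁) * a) ≤ C * ((2 * (M * μ / l₀) + μ * C₁) * a) :=
    mul_le_mul_of_nonneg_right (hr k).2 (by positivity)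
  have h6 : c' * e ≤ r k * (2 * (γ₀ * l₀) * e) := by
    calc c' * e ≤ c * (2 * (γ₀ * l₀)) * e := by gcongr; exact min_le_right _ _
      _ = c * (2 * (γ₀ * l₀) * e) := by ring
      _ ≤ _ := mul_le_mul_of_nonneg_right (hr k).1 (by positivity)
  linarith [(hTW k (x (k + 1) - w)).1, (hTW k (x k - w)).2]

theorem exists_tendsto_and_summable_of_quasiFejer {x : ℕ → H} {T : ℕ → H →L[ℝ] H}
    (hT : ∀ k, (T k).IsPositive) {φ : ℕ → ℝ} (hφ : Antitone φ) {c C m : ℝ} (hc : 0 < c)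
    (hC : 0 ≤ C) (hm : ∀ k, m ≤ φ k) {w : H}
    (h : ∀ k, normSq (T (k + 1)) (x (k + 1) - w) ≤ normSq (T k) (x k - w)
      + C * (φ k - φ (k + 1)) - c * (φ k - m)) :
    (∃ l, Tendsto (fun k => normSq (T k) (x k - w)) atTop (𝓝 l)) ∧
      Summable fun k => φ k - m := by
  have ha0 : ∀ k, 0 ≤ φ k - φ (k + 1) := fun k => sub_nonneg.2 (hφ (Nat.le_succ k))
  have has : Summable fun k => φ k - φ (k + 1) := by
    refine summable_of_sum_range_le (c := φ 0 - m) ha0 fun k => ?_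
    rw [Finset.sum_range_sub']
    linarith [hm k]
  obtain ⟨h1, h2⟩ := exists_tendsto_and_summable_of_le_add_sub
    (fun k => normSq_nonneg (hT k) (x k - w)) (has.mul_left C)
    (fun k => mul_nonneg hC (ha0 k)) (fun k => mul_nonneg hc.le (sub_nonneg.2 (hm k))) h
  exact ⟨h1, (summable_mul_left_iff hc.ne').1 h2⟩

end Convergence

end VMFBS

theorem mainTheorem3 {H : Type*} [NormedAddCommGroup H] [InnerProductSpace ℝ H] [CompleteSpace H]
    (f g : H → EReal) (hf : VMFBS.IsProperConvexLSC f) (hg : VMFBS.IsProperConvexLSC g)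
    (hdom : VMFBS.dom g ⊆ VMFBS.dom f)
    (W : ℕ → H →L[ℝ] H) (hW : VMFBS.IsMetricSequence W)
    (hmetrics : VMFBS.AlmostMonotoneMetrics W ∨ VMFBS.SummableEigenvalueGaps W)
    (gradf : H → H)
    (hgrad : ∀ x ∈ VMFBS.dom g,
      VMFBS.HasGateauxGradientAt (ContinuousLinearMap.id ℝ H) f x (gradf x))
    (L : ℝ≥0) (hLip : LipschitzOnWith L gradf (VMFBS.dom g))
    (γ lam : ℕ → ℝ) (x y : ℕ → H) (hxy : VMFBS.IsForwardBackward W f g γ lam x y)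
    (hlam : 0 < ⨅ k, lam k) (hγ : 0 < ⨅ k, γ k)
    (hstep : ⨆ k, ENNReal.ofReal (γ k * lam k / VMFBS.minEig (W k)) < 2 / (L : ℝ≥0∞)) :
    Antitone (fun k => f (x k) + g (x k)) ∧
    (⊥ < ⨅ k, (f (x k) + g (x k)) → Summable fun k => ‖x (k + 1) - x k‖ ^ 2) ∧
    ((VMFBS.argmin (fun z => f z + g z)).Nonempty →
      (∃ a ∈ VMFBS.argmin (fun z => f z + g z),
        VMFBS.WeaklyConverges x a ∧ VMFBS.WeaklyConverges y a) ∧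
      Tendsto (fun k => f (y k) + g (y k)) atTop (𝓝 (⨅ z, (f z + g z))) ∧
      Tendsto (fun k => f (x k) + g (x k)) atTop (𝓝 (⨅ z, (f z + g z))) ∧
      (fun k => ((f (x k) + g (x k)) - ⨅ z, (f z + g z)).toReal)
        =o[atTop] fun k : ℕ => 1 / (k : ℝ)) ∧
    (VMFBS.argmin (fun z => f z + g z) = ∅ →
      Tendsto (fun k => ‖x k‖) atTop atTop ∧
      Tendsto (fun k => f (x k) + g (x k)) atTop (𝓝 (⨅ z, (f z + g z)))) := by
  have hpos := hW.1
  obtain ⟨M, hM0, hLM, hM⟩ := VMFBS.exists_stepsize_bound hW hstep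
  have hxm := hxy.x_mem hg
  have hym := hxy.y_mem hg
  have hl : ∀ k, (⨅ k, lam k) ≤ lam k :=
    fun k => ciInf_le ⟨0, by rintro _ ⟨j, rfl⟩; exact (hxy.relax_pos j).le⟩ k
  have hγ' : ∀ k, (⨅ k, γ k) ≤ γ k :=
    fun k => ciInf_le ⟨0, by rintro _ ⟨j, rfl⟩; exact (hxy.stepsize_pos j).le⟩ k
  have hdec := hxy.antitone_toReal hf hg hpos hgrad hLip hM0 hLM hM
  obtain ⟨C₁, hC₁, hsq⟩ := hxy.exists_sq_step_le hf hg hpos hgrad hLip hM0 hLM hM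
  obtain ⟨T, c, C, hT, hTanti, hc, hC, hTc, hfejer⟩ := hxy.exists_quasiFejer hf hg hdom hW hmetrics
    hgrad hLip hM0 hLM hM hlam hl hγ hγ'
  set φ : ℕ → ℝ := fun k => (f (x k)).toReal + (g (x k)).toReal with hφ
  have hF : ∀ k, f (x k) + g (x k) = (φ k : EReal) := fun k => VMFBS.add_eq_coe hf hg hdom (hxm k)
  have hanti : Antitone (fun k => f (x k) + g (x k)) := fun i j hij => by
    simp only [hF]
    exact_mod_cast hdec hij
  have hbelow : ∀ w ∈ VMFBS.dom g, (∀ k, (f w).toReal + (g w).toReal ≤ φ k) →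
      (∃ l, Tendsto (fun k => VMFBS.normSq (T k) (x k - w)) atTop (𝓝 l)) ∧
        Summable fun k => φ k - ((f w).toReal + (g w).toReal) := fun w hw hle =>
    VMFBS.exists_tendsto_and_summable_of_quasiFejer hT hdec hc hC hle fun k => hfejer k w hw (hle k)
  have hsummable : (∃ m, ∀ k, m ≤ φ k) → Summable fun k => ‖x (k + 1) - x k‖ ^ 2 := by
    rintro ⟨m, hm⟩
    refine summable_of_sum_range_le (c := C₁ * (φ 0 - m)) (fun k => sq_nonneg _) fun k => ?_
    calc ∑ j ∈ Finset.range k, ‖x (j + 1) - x j‖ ^ 2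
        ≤ ∑ j ∈ Finset.range k, C₁ * (φ j - φ (j + 1)) := Finset.sum_le_sum fun j _ => hsq j
      _ = C₁ * (φ 0 - φ k) := by rw [← Finset.mul_sum, Finset.sum_range_sub']
      _ ≤ _ := by gcongr; exact hm k
  have hlim : Tendsto (fun k => f (x k) + g (x k)) atTop (𝓝 (⨅ z, (f z + g z))) := by
    have h1 := tendsto_atTop_iInf hanti
    convert h1 using 2
    -- If the value at `w` were below some `z` that bounds all `φ k` from below, the gaps would be
    -- summable yet bounded away from 0.
    refine le_antisymm (le_iInf fun k => iInf_le _ (x k)) (le_iInf fun w => ?_)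
    by_cases hw : w ∈ VMFBS.dom g
    · rw [VMFBS.add_eq_coe hf hg hdom hw]
      refine EReal.le_of_forall_lt_iff_le.1 fun z hz => ?_
      have hz : (f w).toReal + (g w).toReal < z := by exact_mod_cast hz
      by_contra hlt
      have hz' : ∀ k, z ≤ φ k := fun k => by
        have := (not_le.1 hlt).le.trans (iInf_le _ k)
        rw [hF] at this
        exact_mod_cast this
      have hs := (hbelow w hw fun k => hz.le.trans (hz' k)).2.tendsto_atTop_zero
      have := ge_of_tendsto' hs fun k => sub_le_sub_right (hz' k) _
      linarith
    · have : g w = ⊤ := by simpa [VMFBS.dom] using hw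
      rw [this, EReal.add_top_of_ne_bot (hf.ne_bot w)]
      exact le_top
  refine ⟨hanti, fun hinf => hsummable ?_, ?_, fun hempty => ⟨?_, hlim⟩⟩
  · obtain ⟨m, -, hm⟩ := EReal.lt_iff_exists_real_btwn.1 hinf
    refine ⟨m, fun k => ?_⟩
    have := hm.le.trans (iInf_le _ k)
    rw [hF] at this
    exact_mod_cast this
  · intro hne
    have hSmem : ∀ w ∈ VMFBS.argmin (fun z => f z + g z), w ∈ VMFBS.dom g ∧
        (⨅ z, (f z + g z)) = (((f w).toReal + (g w).toReal : ℝ) : EReal) := fun w hw => by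
      have hw' : f w + g w = ⨅ z, (f z + g z) := hw
      have hwd : w ∈ VMFBS.dom g := by
        refine VMFBS.mem_dom_of_add_lt_top hf ?_
        rw [hw']
        refine lt_of_le_of_lt (iInf_le _ (x 0)) ?_
        rw [hF]
        exact EReal.coe_lt_top _
      exact ⟨hwd, by rw [← hw', VMFBS.add_eq_coe hf hg hdom hwd]⟩
    have hle : ∀ w ∈ VMFBS.argmin (fun z => f z + g z), ∀ z ∈ VMFBS.dom g,
        (f w).toReal + (g w).toReal ≤ (f z).toReal + (g z).toReal := fun w hw z hz => by
      have h1 : (⨅ z, (f z + g z)) ≤ f z + g z := iInf_le _ z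
      rw [(hSmem w hw).2, VMFBS.add_eq_coe hf hg hdom hz] at h1
      exact_mod_cast h1
    obtain ⟨a, haS, ha⟩ := VMFBS.exists_weak_limit_of_quasiFejer hT hTanti hc hTc hne
      (fun w hw => (hbelow w (hSmem w hw).1 fun k => hle w hw _ (hxm k)).1)
      (fun U b hU hb => VMFBS.mem_argmin_of_weak_limit hf hg hdom (hlim.mono_left hU) hb)
    obtain ⟨had, hinf⟩ := hSmem a haS
    set m : ℝ := (f a).toReal + (g a).toReal with hm
    have hsum : Summable fun k => φ k - m := (hbelow a had fun k => hle a haS _ (hxm k)).2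
    -- The steps `lam k • (y k - x k)` vanish by square summability, and `lam k` is bounded away
    -- from 0.
    have hd : Tendsto (fun k => y k - x k) atTop (𝓝 0) := by
      have h1 := (hsummable ⟨m, fun k => hle a haS _ (hxm k)⟩).tendsto_atTop_zero.sqrt
      rw [Real.sqrt_zero] at h1
      have h2 := h1.const_mul (⨅ k, lam k)⁻¹
      rw [mul_zero] at h2
      refine squeeze_zero_norm (fun k => ?_) h2
      rw [Real.sqrt_sq (norm_nonneg _), le_inv_mul_iff₀ hlam, hxy.relax, add_sub_cancel_left,
        norm_smul, Real.norm_of_nonneg (hxy.relax_pos k).le]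
      gcongr
      exact hl k
    refine ⟨⟨a, haS, VMFBS.weaklyConverges_of_inner ha, VMFBS.weaklyConverges_of_inner fun v => ?_⟩,
      ?_, hlim, ?_⟩
    · have h1 := (ha v).add (hd.inner (tendsto_const_nhds (x := v)))
      simpa [← inner_add_left] using h1
    · rw [hinf]
      have hφm : Tendsto φ atTop (𝓝 m) := by
        simpa using hsum.tendsto_atTop_zero.add_const m
      have h2 : Tendsto (fun k => φ k + L / 2 * ‖y k - x k‖ ^ 2) atTop (𝓝 m) := by
        simpa using hφm.add ((hd.norm.pow 2).const_mul (L / 2 : ℝ))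
      simp only [fun k => VMFBS.add_eq_coe hf hg hdom (hym k)]
      exact EReal.tendsto_coe.2 (tendsto_of_tendsto_of_tendsto_of_le_of_le tendsto_const_nhds h2
        (fun k => hle a haS _ (hym k)) fun k => hxy.value_y_le hf hg hpos hgrad hLip k)
    · have h1 : ∀ k, ((f (x k) + g (x k)) - ⨅ z, (f z + g z)).toReal = φ k - m := fun k => by
        rw [hF, hinf, ← EReal.coe_sub, EReal.toReal_coe]
      simp only [h1]
      have h2 := VMFBS.tendsto_nat_mul_of_antitone_summable
        (fun i j hij => sub_le_sub_right (hdec hij) m) hsum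
      refine (isLittleO_iff_tendsto' ?_).2 (h2.congr fun k => ?_)
      · filter_upwards [eventually_gt_atTop 0] with k hk h0
        have : (0 : ℝ) < k := by exact_mod_cast hk
        exact absurd h0 (by positivity)
      · rw [div_div_eq_mul_div, div_one, mul_comm]
  · by_contra hnot
    rw [tendsto_atTop] at hnot
    push Not at hnot
    obtain ⟨R, hR⟩ := hnot
    -- An ultrafilter concentrated on these bounded iterates yields a weak cluster point, which is a
    -- minimizer by `hlim`.
    have hfr : ∃ᶠ k in atTop, ‖x k‖ ≤ R := hR.mono fun k hk => hk.le
    have : (atTop ⊓ 𝓟 {k | ‖x k‖ ≤ R}).NeBot := frequently_mem_iff_neBot.1 hfr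
    obtain ⟨U, hU'⟩ := Filter.exists_ultrafilter_le (atTop ⊓ 𝓟 {k | ‖x k‖ ≤ R})
    obtain ⟨hU, hUR⟩ := le_inf_iff.1 hU'
    rw [le_principal_iff] at hUR
    obtain ⟨a, ha⟩ := VMFBS.exists_weak_limit_ultrafilter U hUR
    have := VMFBS.mem_argmin_of_weak_limit hf hg hdom (hlim.mono_left hU) ha
    rw [hempty] at this
    exact this
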